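/- **Setting.** Let $Y,U$ be real Hilbert spaces, $Q\subset\mathbb R^n$ a nonempty bounded polyhedron with nonempty interior, $U_{ad}\subset U$ nonempty, closed and convex, $A\in L[Y,Y^*]$ an isomorphism, $B\in L[U,Y^*]$, and $S:=A^{-1}B$. Let $F,f:Q\times Y\times U\to\mathbb R$ be bounded from below, convex and continuously Fréchet differentiable, and assume: * for every $M\ge0$ there is $L_M\ge0$ such that, for all $\beta,\beta_1,\beta_2\in Q$, all $y_1,y_2\in Y$ of norm at most $M$ and all $u,u_1,u_2\in U_{ad}$ of norm at most $M$, $$\|f'_\beta(\beta_1,y_1,u_1)-f'_\beta(\beta_2,y_2,u_2)\|\le L_M(\|\beta_1-\beta_2\|+\|y_1-y_2\|+\|u_1-u_2\|),$$ $$|F(\beta,y_1,u_1)-F(\beta,y_2,u_2)|\le L_M(\|y_1-y_2\|+\|u_1-u_2\|),$$ $$\|f'_u(\beta_1,Su,u)-f'_u(\beta_2,Su,u)\|\le L_M\|\beta_1-\beta_2\|,\qquad \|f'_y(\beta_1,Su,u)-f'_y(\beta_2,Su,u)\|\le L_M\|\beta_1-\beta_2\|;$$ * there is $\mu>0$ such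 that, for all $\beta\in Q$ and $u_1,u_2\in U_{ad}$, $$f(\beta,Su_2,u_2)\ge f(\beta,Su_1,u_1)+\langle f'_y(\beta,Su_1,u_1),S(u_2-u_1)\rangle+\langle f'_u(\beta,Su_1,u_1),u_2-u_1\rangle+\tfrac\mu2\|u_2-u_1\|_U^2.$$ Let $\varphi(\beta):=\inf\{f(\beta,y,u): (y,u)\in Y\times U_{ad},\ Ay=Bu\}$ for $\beta\in Q$. The problem (OVR) is to minimize $F(\beta,y,u)$ subject to $\beta\in Q$, $f(\beta,y,u)\le\varphi(\beta)$, $Ay-Bu=0$, $u\in U_{ad}$. For a nondegenerate $n$-simplex $T\subset Q$ let $\xi_T$ be the affine interpolant of $\varphi$ in the vertices of $T$, let $\operatorname{vol}(T)$ be its volume, and let $\rho(T):=\operatorname{diam}(B_T)/\operatorname{diam}(T)$, where $B_T$ is the largest ball contained in $T$. The problem (OVR$(\xi,T)$) is to minimize $F(\beta,y,u)$ subject to $\beta\in T$, $f(\beta,y,u)\le\xi_T(\beta)$, $Ay-Bu=0$, $u\in U_{ad}$. **Algorithm 1.** * (S1) Choose a finite set $\mathcal T_1$ of $n$-simplices with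 $\bigcup_{T\in\mathcal T_1}T=Q$ and $q,\rho\in(0,1)$ with $\rho\le\min_{T\in\mathcal T_1}\rho(T)$. Set $\mathcal T_0:=\emptyset$ and $k:=1$. * (S2) For each $T\in\mathcal T_k\setminus\mathcal T_{k-1}$ compute a global solution $(\beta_T,y_T,u_T)$ of (OVR$(\xi,T)$); for $T\in\mathcal T_k\cap\mathcal T_{k-1}$ keep the one already computed. Select $\bar T_k\in\mathcal T_k$ minimizing $F(\beta_T,y_T,u_T)$ over $T\in\mathcal T_k$, and let $(\beta_k,y_k,u_k):=(\beta_{\bar T_k},y_{\bar T_k},u_{\bar T_k})$. * (S3) If $f(\beta_k,y_k,u_k)=\varphi(\beta_k)$, stop. Otherwise construct $\mathcal T_{k+1}$ from $\mathcal T_k$ by replacing $\bar T_k$ with finitely many $n$-simplices whose union is $\bar T_k$, in such a way that $\bar T_k\notin\mathcal T_{k+1}$ and that $\operatorname{vol}(T)\le q\operatorname{vol}(\bar T_k)$ and $\rho(T)\ge\rho$ for all $T\in\mathcal T_{k+1}\setminus\mathcal T_k$. Set $k:=k+1$ and go to (S2). **Theorem.** Under these assumptions, each subproblem (OVR$(\xi,T)$),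 $T\subset Q$ a nondegenerate $n$-simplex, has a global solution. Consider any run of Algorithm 1, with any admissible choices, that either terminates in (S3) or continues indefinitely. Either it stops at some $k$, and then $(\beta_k,y_k,u_k)$ is a global solution of (OVR); or it produces an infinite sequence $(\beta_k,y_k,u_k)_{k\ge1}$, which has a subsequence converging strongly in $\mathbb R^n\times Y\times U$ to a global solution of (OVR). If (OVR) has a unique global solution $(\bar\beta,\bar y,\bar u)$ and the run does not stop, then the whole sequence $(\beta_k,y_k,u_k)$ converges strongly to $(\bar\beta,\bar y,\bar u)$. -/

import Mathlib

open Set Filter Topology MeasureTheory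

noncomputable section

namespace BilevelOC

/-- The Euclidean space `ℝⁿ`. -/
abbrev Euc (n : ℕ) : Type := EuclideanSpace ℝ (Fin n)

/-- A (not necessarily bounded) polyhedron: a finite intersection of closed halfspaces. -/
def IsPolyhedron {n : ℕ} (Q : Set (Euc n)) : Prop :=
  ∃ (m : ℕ) (a : Fin m → Euc n) (b : Fin m → ℝ),
    (∀ i, a i ≠ 0) ∧ Q = {x | ∀ i, inner ℝ (a i) x ≤ b i}

/-- A nondegenerate `n`-simplex in `ℝⁿ`, given by its `n + 1` affinely independent vertices
(`n + 1` affinely independent points of `ℝⁿ` are the same as an affine basis). -/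
abbrev Simplex (n : ℕ) : Type := AffineBasis (Fin (n + 1)) ℝ (Euc n)

namespace Simplex

variable {n : ℕ}

/-- The simplex as a subset of `ℝⁿ`. -/
def carrier (T : Simplex n) : Set (Euc n) := convexHull ℝ (range T)

/-- The affine function that agrees with `φ` at the vertices of `T`
(`T.coord i` is the `i`-th barycentric coordinate). -/
def interp (T : Simplex n) (φ : Euc n → ℝ) (β : Euc n) : ℝ :=
  ∑ i, T.coord i β * φ (T i)

/-- The `n`-dimensional volume. -/
def vol (T : Simplex n) : ℝ := (volume : Measure (Euc n)).real T.carrier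

/-- The diameter of the largest ball contained in the simplex. -/
def inDiam (T : Simplex n) : ℝ :=
  sSup {d | ∃ (c : Euc n) (r : ℝ),
    Metric.closedBall c r ⊆ T.carrier ∧ d = Metric.diam (Metric.closedBall c r)}

/-- The aspect ratio `diam B_T / diam T`, with `B_T` the largest ball contained in `T`. -/
def aspectRatio (T : Simplex n) : ℝ := T.inDiam / Metric.diam T.carrier

end Simplex

/-- `x` is a global solution of the problem of minimizing `J` over the feasible set `K`. -/
def IsGlobalSolution {X : Type*} (J : X → ℝ) (K : Set X) (x : X) : Prop :=
  x ∈ K ∧ ∀ z ∈ K, J x ≤ J z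

/-- What the algorithm has at hand after the solution step of an iteration: the current
subdivision, the stored solutions of the subproblems on its simplices (the values of `sol`
off `mesh` are irrelevant), and the selected simplex. -/
structure AlgState (n : ℕ) (Y U : Type*) where
  mesh : Set (Simplex n)
  sol : Simplex n → Euc n × Y × U
  cell : Simplex n

/-- The iterate `(β_k, y_k, u_k)`: the stored solution on the selected simplex. -/
def AlgState.iterate {n : ℕ} {Y U : Type*} (s : AlgState n Y U) :
    Euc n × Y × U := s.sol s.cell

/-- The data of the bilevel problem. A point of `ℝⁿ × Y × U` is written `(β, y, u)`.
Only the values of `F` and `f` on `Q × Y × U` matter. -/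
structure Problem (n : ℕ) (Y U : Type*)
    [NormedAddCommGroup Y] [InnerProductSpace ℝ Y]
    [NormedAddCommGroup U] [InnerProductSpace ℝ U] where
  /-- the admissible set of the upper-level variable -/
  Q : Set (Euc n)
  /-- the admissible set of the control -/
  Uad : Set U
  /-- the operator of the state equation, an isomorphism onto the dual of `Y` -/
  A : Y ≃L[ℝ] StrongDual ℝ Y
  /-- the control operator -/
  B : U →L[ℝ] StrongDual ℝ Y
  /-- the upper-level objective -/
  F : Euc n × Y × U → ℝ
  /-- the lower-level objective -/
  f : Euc n × Y × U → ℝ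

namespace Problem

variable {n : ℕ} {Y U : Type*}
  [NormedAddCommGroup Y] [InnerProductSpace ℝ Y]
  [NormedAddCommGroup U] [InnerProductSpace ℝ U]

/-- The control-to-state map `S = A⁻¹ B`. -/
def S (P : Problem n Y U) : U →L[ℝ] Y :=
  (P.A.symm : StrongDual ℝ Y →L[ℝ] Y).comp P.B

/-- The common domain `Q × Y × U` of the two objectives. -/
def dom (P : Problem n Y U) : Set (Euc n × Y × U) := P.Q ×ˢ univ

/-- The partial derivative of `f` with respect to `β`, taken within the closed set `Q`. -/
def fβ (P : Problem n Y U) (β : Euc n) (y : Y) (u : U) : StrongDual ℝ (Euc n) :=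
  fderivWithin ℝ (fun b => P.f (b, y, u)) P.Q β

/-- The partial derivative of `f` with respect to `y`. -/
def fy (P : Problem n Y U) (β : Euc n) (y : Y) (u : U) : StrongDual ℝ Y :=
  fderiv ℝ (fun z => P.f (β, z, u)) y

/-- The partial derivative of `f` with respect to `u`. -/
def fu (P : Problem n Y U) (β : Euc n) (y : Y) (u : U) : StrongDual ℝ U :=
  fderiv ℝ (fun v => P.f (β, y, v)) u

/-- The standing assumptions (besides `Y` and `U` being complete). -/
structure StandingAssumptions (P : Problem n Y U) : Prop where
  Q_polyhedron : IsPolyhedron P.Q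
  Q_bounded : Bornology.IsBounded P.Q
  Q_nonempty : P.Q.Nonempty
  Q_interior : (interior P.Q).Nonempty
  Uad_nonempty : P.Uad.Nonempty
  Uad_closed : IsClosed P.Uad
  Uad_convex : Convex ℝ P.Uad
  F_bddBelow : BddBelow (P.F '' P.dom)
  f_bddBelow : BddBelow (P.f '' P.dom)
  F_convex : ConvexOn ℝ P.dom P.F
  f_convex : ConvexOn ℝ P.dom P.f
  F_contDiff : ContDiffOn ℝ 1 P.F P.dom
  f_contDiff : ContDiffOn ℝ 1 P.f P.dom
  /-- Lipschitz continuity on bounded sets -/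
  lipschitz : ∀ M : ℝ, 0 ≤ M → ∃ L : ℝ, 0 ≤ L ∧
    ∀ β ∈ P.Q, ∀ β₁ ∈ P.Q, ∀ β₂ ∈ P.Q,
    ∀ y₁ ∈ Metric.closedBall (0 : Y) M, ∀ y₂ ∈ Metric.closedBall (0 : Y) M,
    ∀ u ∈ P.Uad ∩ Metric.closedBall (0 : U) M,
    ∀ u₁ ∈ P.Uad ∩ Metric.closedBall (0 : U) M,
    ∀ u₂ ∈ P.Uad ∩ Metric.closedBall (0 : U) M,
      ‖P.fβ β₁ y₁ u₁ - P.fβ β₂ y₂ u₂‖ ≤ L * (‖β₁ - β₂‖ + ‖y₁ - y₂‖ + ‖u₁ - u₂‖) ∧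
      |P.F (β, y₁, u₁) - P.F (β, y₂, u₂)| ≤ L * (‖y₁ - y₂‖ + ‖u₁ - u₂‖) ∧
      ‖P.fu β₁ (P.S u) u - P.fu β₂ (P.S u) u‖ ≤ L * ‖β₁ - β₂‖ ∧
      ‖P.fy β₁ (P.S u) u - P.fy β₂ (P.S u) u‖ ≤ L * ‖β₁ - β₂‖
  /-- strong convexity of the reduced lower-level objective, uniformly in `β` -/
  strongly_convex : ∃ μ : ℝ, 0 < μ ∧ ∀ β ∈ P.Q, ∀ u₁ ∈ P.Uad, ∀ u₂ ∈ P.Uad,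
    P.f (β, P.S u₁, u₁) + P.fy β (P.S u₁) u₁ (P.S (u₂ - u₁)) + P.fu β (P.S u₁) u₁ (u₂ - u₁)
      + μ / 2 * ‖u₂ - u₁‖ ^ 2 ≤ P.f (β, P.S u₂, u₂)

/-- The optimal-value function `φ(β) = inf {f(β, y, u) | (y, u) ∈ Y × Uad, A y = B u}`
of the lower-level problem. -/
def φ (P : Problem n Y U) (β : Euc n) : ℝ :=
  sInf ((fun p : Y × U => P.f (β, p.1, p.2)) '' {p | p.2 ∈ P.Uad ∧ P.A p.1 = P.B p.2})

/-- The points `(β, y, u)` with `β ∈ D`, `f(β, y, u) ≤ ξ(β)`, `A y - B u = 0`, `u ∈ Uad`. -/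
def feasible (P : Problem n Y U) (D : Set (Euc n)) (ξ : Euc n → ℝ) : Set (Euc n × Y × U) :=
  {x | x.1 ∈ D ∧ P.f x ≤ ξ x.1 ∧ P.A x.2.1 - P.B x.2.2 = 0 ∧ x.2.2 ∈ P.Uad}

/-- `x` is a global solution of the optimal-value reformulation: minimize `F` subject to
`β ∈ Q`, `f(β, y, u) ≤ φ(β)`, `A y - B u = 0`, `u ∈ Uad`. -/
def SolvesOVR (P : Problem n Y U) (x : Euc n × Y × U) : Prop :=
  IsGlobalSolution P.F (P.feasible P.Q P.φ) x

/-- `x` is a global solution of the subproblem on the simplex `T`: minimize `F` subject to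
`β ∈ T`, `f(β, y, u) ≤ ξ_T(β)`, `A y - B u = 0`, `u ∈ Uad`, where `ξ_T` is the affine
interpolant of `φ` in the vertices of `T`. -/
def SolvesOn (P : Problem n Y U) (T : Simplex n) (x : Euc n × Y × U) : Prop :=
  IsGlobalSolution P.F (P.feasible T.carrier (T.interp P.φ)) x

/-- The selected simplex minimizes the value `F(β_T, y_T, u_T)` over the simplices of the
subdivision. -/
def SelectsMin (P : Problem n Y U) (s : AlgState n Y U) : Prop :=
  s.cell ∈ s.mesh ∧ ∀ T ∈ s.mesh, P.F (s.sol s.cell) ≤ P.F (s.sol T)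

/-- First iteration: a finite subdivision of `Q` all of whose simplices have aspect ratio at
least `ρ`; every subproblem is solved globally. -/
structure IsInitial (P : Problem n Y U) (ρ : ℝ) (s : AlgState n Y U) : Prop where
  finite : s.mesh.Finite
  covers : (⋃ T ∈ s.mesh, T.carrier) = P.Q
  aspect : ∀ T ∈ s.mesh, ρ ≤ T.aspectRatio
  solves : ∀ T ∈ s.mesh, P.SolvesOn T (s.sol T)
  selects : P.SelectsMin s

/-- The termination test `f(β_k, y_k, u_k) = φ(β_k)`. -/
def Stops (P : Problem n Y U) (s : AlgState n Y U) : Prop :=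
  P.f s.iterate = P.φ s.iterate.1

/-- The subdivision `mesh'` arises from `mesh` by a refinement of `T`: the simplex `T` is
replaced by finitely many simplices with union `T`. -/
def IsRefinement (mesh : Set (Simplex n)) (T : Simplex n) (mesh' : Set (Simplex n)) : Prop :=
  T ∉ mesh' ∧ ∃ R : Set (Simplex n), R.Finite ∧ (⋃ T' ∈ R, T'.carrier) = T.carrier ∧
    mesh' = (mesh \ {T}) ∪ R

/-- One pass from an iteration to the next: the selected simplex is refined, the new simplices
satisfy the volume and aspect ratio conditions, the subproblems on the new simplices are solved
globally, the solutions on the old simplices are kept, and a simplex is selected. -/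
structure IsStep (P : Problem n Y U) (q ρ : ℝ) (s s' : AlgState n Y U) : Prop where
  refines : IsRefinement s.mesh s.cell s'.mesh
  volume_le : ∀ T ∈ s'.mesh \ s.mesh, T.vol ≤ q * s.cell.vol
  aspect : ∀ T ∈ s'.mesh \ s.mesh, ρ ≤ T.aspectRatio
  solves : ∀ T ∈ s'.mesh \ s.mesh, P.SolvesOn T (s'.sol T)
  keeps : ∀ T ∈ s'.mesh ∩ s.mesh, s'.sol T = s.sol T
  selects : P.SelectsMin s'

/-- A complete run of the algorithm with parameters `q, ρ ∈ (0, 1)`. Here `s k` is the state in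
iteration `k + 1`, and `N` is the index of the state at which the algorithm terminates
(`N = ⊤` if it does not terminate; the states after the index `N` are irrelevant). -/
structure IsRun (P : Problem n Y U) (q ρ : ℝ) (N : ℕ∞) (s : ℕ → AlgState n Y U) : Prop where
  q_mem : q ∈ Ioo (0 : ℝ) 1
  ρ_mem : ρ ∈ Ioo (0 : ℝ) 1
  init : P.IsInitial ρ (s 0)
  step : ∀ k : ℕ, (k : ℕ∞) < N → ¬ P.Stops (s k) ∧ P.IsStep q ρ (s k) (s (k + 1))
  terminates : ∀ k : ℕ, N = (k : ℕ∞) → P.Stops (s k)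

end Problem

end BilevelOC

end

/-! The state equation forces y = S u, so everything reduces to pairs (β, u), with `lift` restoring
the state. Joint convexity of f makes φ convex, so on each simplex the interpolant lies above φ
(`φ_le_interp`). The subproblems are therefore relaxations of (OVR), and since the simplices cover
Q, the best subproblem value is a lower bound for (OVR) (`le_of_mem_feasible`). If the test in (S3)
succeeds, the iterate is feasible for (OVR), hence optimal.

If the run is infinite, each selected simplex is removed and its replacements shrink in volume by
the factor q. A finite mesh allows only finitely many selections of large simplices, so the selected
volumes tend to 0; the aspect ratio bound turns this into diameters tending to 0 (`tendsto_diam`).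
As φ is Lipschitz, the relaxation error at the iterates vanishes. Compactness of Q gives a limit b
of the β_k along a subsequence, and quadratic growth of the lower-level objective around its
minimizer at b (`norm_sub_sq_le`) forces strong convergence of the controls. The lower bound passes
to the limit.

Existence of minimizers is obtained from Cauchy sequences generated by uniform convexity, in place
of weak compactness. -/

/-! ### Existence of minimizers through uniform convexity -/

/-- A decreasing sequence of nonempty closed convex sets has a common point as soon as some
uniformly convex functional has bounded infima on it. -/
theorem nonempty_iInter_of_uniformly_convex {X : Type*} [NormedAddCommGroup X] [NormedSpace ℝ X]
    [CompleteSpace X] {C : ℕ → Set X} {h : X → ℝ} {c M : ℝ} (hanti : Antitone C)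
    (hcl : ∀ k, IsClosed (C k)) (hcv : ∀ k, Convex ℝ (C k)) (hne : ∀ k, (C k).Nonempty)
    (hc : 0 < c)
    (hmid : ∀ x ∈ C 0, ∀ y ∈ C 0, h (midpoint ℝ x y) + c * ‖x - y‖ ^ 2 ≤ (h x + h y) / 2)
    (hbelow : BddBelow (h '' C 0)) (habove : ∀ x ∈ C 0, h x ≤ M) :
    (⋂ k, C k).Nonempty := by
  have h0 : ∀ k, C k ⊆ C 0 := fun k => hanti (Nat.zero_le k)
  have hbd : ∀ k, BddBelow (h '' C k) := fun k => hbelow.mono (image_mono (h0 k))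
  set m : ℕ → ℝ := fun k => sInf (h '' C k) with hm
  have hmono : Monotone m := fun i j hij =>
    csInf_le_csInf (hbd i) ((hne j).image h) (image_mono (hanti hij))
  have hmle : ∀ k, ∀ x ∈ C k, m k ≤ h x := fun k x hx => csInf_le (hbd k) (mem_image_of_mem h hx)
  have hmM : BddAbove (range m) := by
    refine ⟨M, ?_⟩
    rintro _ ⟨k, rfl⟩
    obtain ⟨x, hx⟩ := hne k
    exact (hmle k x hx).trans (habove x (h0 k hx))
  have hlim : Tendsto m atTop (𝓝 (⨆ k, m k)) := tendsto_atTop_ciSup hmono hmM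
  have hex : ∀ k : ℕ, ∃ x ∈ C k, h x < m k + 1 / ((k : ℝ) + 1) := by
    intro k
    obtain ⟨_, ⟨x, hx, rfl⟩, hlt⟩ := exists_lt_of_csInf_lt ((hne k).image h)
      (show sInf (h '' C k) < m k + 1 / ((k : ℝ) + 1) from lt_add_of_pos_right _ (by positivity))
    exact ⟨x, hx, hlt⟩
  choose x hxC hxh using hex
  -- For j ≥ k the midpoint of `x j` and `x k` lies in `C k`, where h ≥ `m k`, while `m j` ≤ sup m.
  -- Inserting this in `hmid` bounds c‖x j - x k‖² by (sup m - m k)/2 + 1/(k+1).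
  set b : ℕ → ℝ := fun k => Real.sqrt ((((⨆ k, m k) - m k) / 2 + 1 / ((k : ℝ) + 1)) / c) with hb
  have hb0 : Tendsto b atTop (𝓝 0) := by
    have h1 : Tendsto (fun k : ℕ => (((⨆ k, m k) - m k) / 2 + 1 / ((k : ℝ) + 1)) / c) atTop
        (𝓝 ((((⨆ k, m k) - (⨆ k, m k)) / 2 + 0) / c)) :=
      (((tendsto_const_nhds.sub hlim).div_const 2).add
        tendsto_one_div_add_atTop_nhds_zero_nat).div_const c
    have h2 := (Real.continuous_sqrt.tendsto _).comp h1
    simpa [Function.comp_def, hb] using h2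
  have hdist : ∀ k j, k ≤ j → dist (x j) (x k) ≤ b k := by
    intro k j hkj
    have hj : x j ∈ C k := hanti hkj (hxC j)
    have h1 := hmid _ (h0 _ (hxC j)) _ (h0 _ (hxC k))
    have h2 := hmle k _ ((hcv k).midpoint_mem hj (hxC k))
    have h3 := hxh j
    have h4 := hxh k
    have h5 : 1 / ((j : ℝ) + 1) ≤ 1 / ((k : ℝ) + 1) := by
      have : (k : ℝ) ≤ j := by exact_mod_cast hkj
      gcongr
    have h6 : m j ≤ ⨆ k, m k := le_ciSup hmM j
    rw [dist_eq_norm]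
    refine Real.le_sqrt_of_sq_le ?_
    rw [le_div_iff₀ hc]
    linarith
  have hcauchy : CauchySeq x := by
    refine cauchySeq_of_le_tendsto_0' b (fun k j hkj => ?_) hb0
    rw [dist_comm]
    exact hdist k j hkj
  obtain ⟨a, ha⟩ := cauchySeq_tendsto_of_complete hcauchy
  refine ⟨a, mem_iInter.2 fun k => (hcl k).mem_of_tendsto ha ?_⟩
  filter_upwards [eventually_ge_atTop k] with j hj
  exact hanti hj (hxC j)

/-- A convex continuous functional, bounded from below on a closed convex set, attains its
infimum if some uniformly convex functional is bounded on its near-minimizers. -/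
theorem exists_isMinOn_of_uniformly_convex {X : Type*} [NormedAddCommGroup X] [NormedSpace ℝ X]
    [CompleteSpace X] {K : Set X} {J h : X → ℝ} {c M : ℝ} (hcl : IsClosed K) (hne : K.Nonempty)
    (hJ : ConvexOn ℝ K J) (hJc : ContinuousOn J K) (hJb : BddBelow (J '' K)) (hc : 0 < c)
    (hmid : ∀ x ∈ K, ∀ y ∈ K, h (midpoint ℝ x y) + c * ‖x - y‖ ^ 2 ≤ (h x + h y) / 2)
    (hbelow : BddBelow (h '' K)) (habove : ∀ x ∈ K, J x ≤ sInf (J '' K) + 1 → h x ≤ M) :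
    ∃ x ∈ K, ∀ z ∈ K, J x ≤ J z := by
  set m := sInf (J '' K) with hm
  -- Sublevel sets of J shrinking to the set of minimizers; index 0 gives the level m + 1 that
  -- appears in `habove`.
  set C : ℕ → Set X := fun k => {x ∈ K | J x ≤ m + 1 / ((k : ℝ) + 1)} with hC
  have hanti : Antitone C := by
    intro i j hij x hx
    refine ⟨hx.1, hx.2.trans ?_⟩
    have : (i : ℝ) ≤ j := by exact_mod_cast hij
    gcongr
  have hC0 : ∀ x ∈ C 0, x ∈ K ∧ J x ≤ m + 1 := by
    rintro x ⟨h1, h2⟩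
    exact ⟨h1, by simpa using h2⟩
  obtain ⟨x, hx⟩ := nonempty_iInter_of_uniformly_convex (C := C) (h := h) (M := M) hanti
    (fun k => hJc.preimage_isClosed_of_isClosed hcl isClosed_Iic)
    (fun k => hJ.convex_le _)
    (fun k => by
      obtain ⟨_, ⟨x, hx, rfl⟩, hlt⟩ := exists_lt_of_csInf_lt (hne.image J)
        (show sInf (J '' K) < m + 1 / ((k : ℝ) + 1) from
          lt_add_of_pos_right _ (by positivity))
      exact ⟨x, hx, hlt.le⟩)
    hc (fun x hx y hy => hmid x (hC0 x hx).1 y (hC0 y hy).1)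
    (hbelow.mono (image_mono fun x hx => (hC0 x hx).1))
    (fun x hx => habove x (hC0 x hx).1 (hC0 x hx).2)
  rw [mem_iInter] at hx
  refine ⟨x, (hx 0).1, fun z hz => ?_⟩
  have h1 : J x ≤ m := by
    have h2 : Tendsto (fun k : ℕ => m + 1 / ((k : ℝ) + 1)) atTop (𝓝 (m + 0)) :=
      tendsto_const_nhds.add tendsto_one_div_add_atTop_nhds_zero_nat
    rw [add_zero] at h2
    exact ge_of_tendsto' h2 fun k => (hx k).2
  exact h1.trans (csInf_le hJb (mem_image_of_mem J hz))

theorem norm_sq_midpoint_add {H : Type*} [NormedAddCommGroup H] [InnerProductSpace ℝ H]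
    (x y : H) : ‖midpoint ℝ x y‖ ^ 2 + 1 / 4 * ‖x - y‖ ^ 2 = (‖x‖ ^ 2 + ‖y‖ ^ 2) / 2 := by
  have h1 := parallelogram_law_with_norm ℝ x y
  rw [midpoint_eq_smul_add, norm_smul, mul_pow]
  norm_num
  nlinarith

/-- A convex continuous functional attains its infimum on a bounded closed convex subset of
the product of two Hilbert spaces if it is bounded from below there. -/
theorem exists_isMinOn_prod {H₁ H₂ : Type*} [NormedAddCommGroup H₁] [InnerProductSpace ℝ H₁]
    [CompleteSpace H₁] [NormedAddCommGroup H₂] [InnerProductSpace ℝ H₂] [CompleteSpace H₂]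
    {K : Set (H₁ × H₂)} {J : H₁ × H₂ → ℝ} (hcl : IsClosed K) (hne : K.Nonempty)
    (hbd : Bornology.IsBounded K) (hJ : ConvexOn ℝ K J) (hJc : ContinuousOn J K)
    (hJb : BddBelow (J '' K)) : ∃ x ∈ K, ∀ z ∈ K, J x ≤ J z := by
  obtain ⟨r, hr⟩ := hbd.exists_norm_le
  -- The product carries the maximum norm, whose square is not uniformly convex; the sum of squares
  -- is, with 1/4 from the parallelogram law.
  refine exists_isMinOn_of_uniformly_convex (h := fun x => ‖x.1‖ ^ 2 + ‖x.2‖ ^ 2)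
    (c := 1 / 4) (M := r ^ 2 + r ^ 2) hcl hne hJ hJc hJb (by norm_num) ?_ ?_ ?_
  · intro x _ y _
    have h1 := norm_sq_midpoint_add x.1 y.1
    have h2 := norm_sq_midpoint_add x.2 y.2
    have e1 : (midpoint ℝ x y).1 = midpoint ℝ x.1 y.1 := by simp [midpoint_eq_smul_add]
    have e2 : (midpoint ℝ x y).2 = midpoint ℝ x.2 y.2 := by simp [midpoint_eq_smul_add]
    have h3 : ‖x - y‖ ^ 2 ≤ ‖x.1 - y.1‖ ^ 2 + ‖x.2 - y.2‖ ^ 2 := by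
      have h4 : ‖x - y‖ = max ‖x.1 - y.1‖ ‖x.2 - y.2‖ := rfl
      rw [h4]
      rcases max_choice ‖x.1 - y.1‖ ‖x.2 - y.2‖ with h | h <;> rw [h] <;>
        nlinarith [sq_nonneg ‖x.1 - y.1‖, sq_nonneg ‖x.2 - y.2‖]
    simp only [e1, e2]
    linarith
  · exact ⟨0, by rintro _ ⟨x, _, rfl⟩; positivity⟩
  · intro x hx _
    have h1 := (norm_fst_le x).trans (hr x hx)
    have h2 := (norm_snd_le x).trans (hr x hx)
    gcongr

/-! ### Simplices: interpolation, volume and diameter -/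

namespace BilevelOC

namespace Simplex

variable {n : ℕ}

theorem isCompact_carrier (T : Simplex n) : IsCompact T.carrier :=
  (finite_range T).isCompact_convexHull ℝ

theorem convex_carrier (T : Simplex n) : Convex ℝ T.carrier := convex_convexHull ℝ _

theorem vertex_mem_carrier (T : Simplex n) (i : Fin (n + 1)) : T i ∈ T.carrier :=
  subset_convexHull ℝ _ (mem_range_self i)

theorem coord_nonneg {T : Simplex n} {β : Euc n} (hβ : β ∈ T.carrier) (i : Fin (n + 1)) :
    0 ≤ T.coord i β := by
  have h : β ∈ {x | ∀ i, 0 ≤ T.coord i x} := by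
    rw [← AffineBasis.convexHull_eq_nonneg_coord]
    exact hβ
  exact h i

theorem interp_vertex (T : Simplex n) (φ : Euc n → ℝ) (i : Fin (n + 1)) :
    T.interp φ (T i) = φ (T i) := by
  simp [interp, AffineBasis.coord_apply]

/-- Interpolation is monotone up to an additive constant on the simplex. -/
theorem interp_le {T : Simplex n} {φ : Euc n → ℝ} {β : Euc n} {c : ℝ} (hβ : β ∈ T.carrier)
    (h : ∀ i, φ (T i) ≤ c) : T.interp φ β ≤ c := by
  have h1 : T.interp φ β ≤ ∑ i, T.coord i β * c :=
    Finset.sum_le_sum fun i _ => mul_le_mul_of_nonneg_left (h i) (coord_nonneg hβ i)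
  rwa [← Finset.sum_mul, T.sum_coord_apply_eq_one, one_mul] at h1

theorem continuous_interp (T : Simplex n) (φ : Euc n → ℝ) : Continuous (T.interp φ) := by
  unfold interp
  refine continuous_finsetSum _ fun i _ => ?_
  exact (T.coord i).continuous_of_finiteDimensional.mul continuous_const

theorem interp_combo (T : Simplex n) (φ : Euc n → ℝ) (x y : Euc n) {a b : ℝ} (hab : a + b = 1) :
    T.interp φ (a • x + b • y) = a * T.interp φ x + b * T.interp φ y := by
  unfold interp
  rw [Finset.mul_sum, Finset.mul_sum, ← Finset.sum_add_distrib]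
  refine Finset.sum_congr rfl fun i _ => ?_
  rw [Convex.combo_affine_apply hab]
  simp only [smul_eq_mul]
  ring

/-- The volume of a simplex controls its diameter if its aspect ratio is bounded below. -/
theorem volume_ge {T : Simplex n} {ρ : ℝ} (hρ : 0 < ρ) (hT : ρ ≤ T.aspectRatio) :
    0 < n ∧ (ρ * Metric.diam T.carrier / 4) ^ n * (volume : Measure (Euc n)).real (Metric.ball 0 1)
      ≤ T.vol := by
  have hd : 0 < Metric.diam T.carrier := by
    -- A zero diameter would give aspect ratio 0, because division by zero yields 0.
    refine lt_of_le_of_ne Metric.diam_nonneg fun h => ?_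
    rw [aspectRatio, ← h, div_zero] at hT
    linarith
  constructor
  · rcases Nat.eq_zero_or_pos n with rfl | h
    · rw [Metric.diam_subsingleton (subsingleton_of_subsingleton)] at hd
      exact absurd hd (lt_irrefl _)
    · exact h
  have hin : ρ * Metric.diam T.carrier ≤ T.inDiam := (le_div_iff₀ hd).1 hT
  have hpos : 0 < ρ * Metric.diam T.carrier := mul_pos hρ hd
  -- Halving gives a strict inequality below the supremum, so some inscribed ball has a diameter
  -- above this bound without the supremum being attained. Passing to its radius costs another
  -- factor 2, whence the 4.
  have hlt : ρ * Metric.diam T.carrier / 2 < T.inDiam := by linarith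
  -- A ball of negative radius is empty, hence contained in the simplex.
  have hne : {d | ∃ (c : Euc n) (r : ℝ), Metric.closedBall c r ⊆ T.carrier ∧
      d = Metric.diam (Metric.closedBall c r)}.Nonempty :=
    ⟨_, T 0, -1, by simp, rfl⟩
  obtain ⟨_, ⟨c, r, hsub, rfl⟩, hr⟩ := exists_lt_of_lt_csSup hne hlt
  have hr0 : 0 ≤ r := by
    by_contra hneg
    rw [Metric.closedBall_eq_empty.2 (not_le.1 hneg), Metric.diam_empty] at hr
    linarith
  have h2 := Metric.diam_closedBall (x := c) hr0
  have h3 : (volume : Measure (Euc n)).real (Metric.closedBall c r) ≤ T.vol :=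
    measureReal_mono hsub T.isCompact_carrier.measure_lt_top.ne
  have h4 : (volume : Measure (Euc n)).real (Metric.closedBall c r)
      = r ^ n * (volume : Measure (Euc n)).real (Metric.ball 0 1) := by
    rw [Measure.addHaar_real_closedBall _ _ hr0, finrank_euclideanSpace_fin]
  rw [h4] at h3
  refine le_trans ?_ h3
  gcongr
  linarith

end Simplex

end BilevelOC

/-! ### The reduced lower-level problem, its value function, and the subproblems -/

namespace BilevelOC

namespace Problem

variable {n : ℕ} {Y U : Type*}
  [NormedAddCommGroup Y] [InnerProductSpace ℝ Y]
  [NormedAddCommGroup U] [InnerProductSpace ℝ U]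
  {P : Problem n Y U}

/-- The embedding `(β, u) ↦ (β, S u, u)`. -/
noncomputable def lift (P : Problem n Y U) : Euc n × U →L[ℝ] Euc n × Y × U :=
  (ContinuousLinearMap.fst ℝ (Euc n) U).prod
    ((P.S.comp (ContinuousLinearMap.snd ℝ (Euc n) U)).prod (ContinuousLinearMap.snd ℝ (Euc n) U))

theorem lift_apply (P : Problem n Y U) (β : Euc n) (u : U) : P.lift (β, u) = (β, P.S u, u) := rfl

theorem state_eq_iff (P : Problem n Y U) (y : Y) (u : U) : P.A y = P.B u ↔ y = P.S u := by
  constructor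
  · intro h
    change y = P.A.symm (P.B u)
    rw [← h, ContinuousLinearEquiv.symm_apply_apply]
  · rintro rfl
    exact P.A.apply_symm_apply _

theorem mem_feasible_iff {D : Set (Euc n)} {ξ : Euc n → ℝ} {x : Euc n × Y × U} :
    x ∈ P.feasible D ξ ↔
      ∃ β ∈ D, ∃ u ∈ P.Uad, P.f (P.lift (β, u)) ≤ ξ β ∧ P.lift (β, u) = x := by
  constructor
  · obtain ⟨β, y, u⟩ := x
    rintro ⟨h1, h2, h3, h4⟩
    have h5 : y = P.S u := (P.state_eq_iff y u).1 (sub_eq_zero.1 h3)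
    subst h5
    exact ⟨β, h1, u, h4, h2, rfl⟩
  · rintro ⟨β, h1, u, h2, h3, rfl⟩
    exact ⟨h1, h3, sub_eq_zero.2 ((P.state_eq_iff _ u).2 rfl), h2⟩

theorem φ_eq (P : Problem n Y U) (β : Euc n) :
    P.φ β = sInf ((fun u => P.f (P.lift (β, u))) '' P.Uad) := by
  unfold φ
  congr 1
  ext t
  constructor
  · rintro ⟨⟨y, u⟩, ⟨hu, hy⟩, rfl⟩
    have h5 : y = P.S u := (P.state_eq_iff y u).1 hy
    subst h5
    exact ⟨u, hu, rfl⟩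
  · rintro ⟨u, hu, rfl⟩
    exact ⟨(P.S u, u), ⟨hu, (P.state_eq_iff _ u).2 rfl⟩, rfl⟩

namespace StandingAssumptions

theorem isClosed_Q (hP : P.StandingAssumptions) : IsClosed P.Q := by
  obtain ⟨m, a, b, -, h⟩ := hP.Q_polyhedron
  rw [h, ofPred_forall]
  exact isClosed_iInter fun i => isClosed_le (by fun_prop) continuous_const

theorem isCompact_Q (hP : P.StandingAssumptions) : IsCompact P.Q :=
  Metric.isCompact_of_isClosed_isBounded hP.isClosed_Q hP.Q_bounded

theorem convex_Q (hP : P.StandingAssumptions) : Convex ℝ P.Q := by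
  intro x hx y hy a b ha hb hab
  exact (hP.f_convex.1 (show (x, (0 : Y), (0 : U)) ∈ P.dom from ⟨hx, mem_univ _⟩)
    (show (y, (0 : Y), (0 : U)) ∈ P.dom from ⟨hy, mem_univ _⟩) ha hb hab).1

theorem lift_mem_dom {β : Euc n} (hβ : β ∈ P.Q) (u : U) : P.lift (β, u) ∈ P.dom :=
  ⟨hβ, mem_univ _⟩

theorem convexOn_comp_lift {G : Euc n × Y × U → ℝ} (hG : ConvexOn ℝ P.dom G) :
    ConvexOn ℝ (P.Q ×ˢ univ) (fun x => G (P.lift x)) := by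
  have h := hG.comp_linearMap (P.lift : Euc n × U →ₗ[ℝ] Euc n × Y × U)
  exact h.subset (fun x hx => ⟨hx.1, mem_univ _⟩)
    (hG.1.linear_preimage (P.lift : Euc n × U →ₗ[ℝ] Euc n × Y × U))

theorem continuousOn_comp_lift {G : Euc n × Y × U → ℝ} (hG : ContDiffOn ℝ 1 G P.dom) :
    ContinuousOn (fun x => G (P.lift x)) (P.Q ×ˢ univ) :=
  hG.continuousOn.comp P.lift.continuous.continuousOn fun _ hx => ⟨hx.1, mem_univ _⟩

theorem bddBelow_lower (hP : P.StandingAssumptions) {β : Euc n} (hβ : β ∈ P.Q) :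
    BddBelow ((fun u => P.f (P.lift (β, u))) '' P.Uad) :=
  hP.f_bddBelow.mono <| by
    rintro _ ⟨u, _, rfl⟩
    exact mem_image_of_mem _ (lift_mem_dom hβ u)

theorem φ_le (hP : P.StandingAssumptions) {β : Euc n} (hβ : β ∈ P.Q) {u : U} (hu : u ∈ P.Uad) :
    P.φ β ≤ P.f (P.lift (β, u)) := by
  rw [P.φ_eq]
  exact csInf_le (hP.bddBelow_lower hβ) (mem_image_of_mem _ hu)

/-- Uniform convexity of the reduced lower-level objective in the control. -/
theorem midpoint_lower (hP : P.StandingAssumptions) : ∃ c : ℝ, 0 < c ∧ ∀ β ∈ P.Q,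
    ∀ u ∈ P.Uad, ∀ v ∈ P.Uad,
      P.f (P.lift (β, midpoint ℝ u v)) + c * ‖u - v‖ ^ 2
        ≤ (P.f (P.lift (β, u)) + P.f (P.lift (β, v))) / 2 := by
  obtain ⟨μ, hμ, h⟩ := hP.strongly_convex
  -- Strong convexity is applied at the midpoint towards u and towards v. On averaging, the
  -- first-order terms cancel, and each quadratic term is μ/2 · ‖(u - v)/2‖².
  refine ⟨μ / 8, by positivity, fun β hβ u hu v hv => ?_⟩
  have hm : midpoint ℝ u v ∈ P.Uad := hP.Uad_convex.midpoint_mem hu hv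
  have h1 := h β hβ _ hm u hu
  have h2 := h β hβ _ hm v hv
  have e1 : u - midpoint ℝ u v = (1 / 2 : ℝ) • (u - v) := by
    rw [midpoint_eq_smul_add]
    norm_num
    module
  have e2 : v - midpoint ℝ u v = (-(1 / 2) : ℝ) • (u - v) := by
    rw [midpoint_eq_smul_add]
    norm_num
    module
  have e3 : ‖(1 / 2 : ℝ) • (u - v)‖ ^ 2 = 1 / 4 * ‖u - v‖ ^ 2 := by
    rw [norm_smul, mul_pow]
    norm_num
  have e4 : ‖(-(1 / 2) : ℝ) • (u - v)‖ ^ 2 = 1 / 4 * ‖u - v‖ ^ 2 := by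
    rw [norm_smul, mul_pow]
    norm_num
  rw [e1, e3] at h1
  rw [e2, e4] at h2
  simp only [map_smul, smul_eq_mul] at h1 h2
  simp only [lift_apply]
  linarith

/-- The lower-level problem is solvable. -/
theorem exists_lower_solution [CompleteSpace U] (hP : P.StandingAssumptions) {β : Euc n}
    (hβ : β ∈ P.Q) : ∃ u ∈ P.Uad, P.f (P.lift (β, u)) = P.φ β := by
  obtain ⟨c, hc, hmid⟩ := hP.midpoint_lower
  have hconv : ConvexOn ℝ P.Uad (fun u => P.f (P.lift (β, u))) := by
    refine ⟨hP.Uad_convex, fun u _ v _ a b ha hb hab => ?_⟩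
    have h := (convexOn_comp_lift hP.f_convex).2 (show (β, u) ∈ P.Q ×ˢ univ from ⟨hβ, mem_univ _⟩)
      (show (β, v) ∈ P.Q ×ˢ univ from ⟨hβ, mem_univ _⟩) ha hb hab
    rwa [Prod.smul_mk, Prod.smul_mk, Prod.mk_add_mk, Convex.combo_self hab] at h
  have hcont : ContinuousOn (fun u => P.f (P.lift (β, u))) P.Uad :=
    (continuousOn_comp_lift hP.f_contDiff).comp (by fun_prop) fun u _ => ⟨hβ, mem_univ _⟩
  -- The objective is its own uniformly convex functional, with M the infimum plus 1.
  obtain ⟨u, hu, hmin⟩ := exists_isMinOn_of_uniformly_convex hP.Uad_closed hP.Uad_nonempty hconv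
    hcont (hP.bddBelow_lower hβ) hc (hmid β hβ) (hP.bddBelow_lower hβ) (fun _ _ h => h)
  refine ⟨u, hu, le_antisymm ?_ (hP.φ_le hβ hu)⟩
  rw [P.φ_eq]
  refine le_csInf (hP.Uad_nonempty.image _) ?_
  rintro _ ⟨v, hv, rfl⟩
  exact hmin v hv

/-- Lower-level minimizers are stable under perturbation of the value. -/
theorem norm_sub_sq_le (hP : P.StandingAssumptions) : ∃ c : ℝ, 0 < c ∧ ∀ β ∈ P.Q,
    ∀ u ∈ P.Uad, ∀ v ∈ P.Uad, P.f (P.lift (β, v)) = P.φ β →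
      c * ‖u - v‖ ^ 2 ≤ P.f (P.lift (β, u)) - P.φ β := by
  obtain ⟨c, hc, hmid⟩ := hP.midpoint_lower
  -- The midpoint of u and v has value at least φ(β), and v has value φ(β); the midpoint inequality
  -- then leaves half of the gap at u.
  refine ⟨2 * c, by positivity, fun β hβ u hu v hv hmin => ?_⟩
  have h1 := hmid β hβ u hu v hv
  have h2 := hP.φ_le hβ (hP.Uad_convex.midpoint_mem hu hv)
  rw [hmin] at h1
  linarith

theorem φ_bddAbove (hP : P.StandingAssumptions) : ∃ C, ∀ β ∈ P.Q, P.φ β ≤ C := by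
  obtain ⟨u, hu⟩ := hP.Uad_nonempty
  have hcont : ContinuousOn (fun β => P.f (P.lift (β, u))) P.Q :=
    (continuousOn_comp_lift hP.f_contDiff).comp (by fun_prop) fun β hβ => ⟨hβ, mem_univ _⟩
  obtain ⟨C, hC⟩ := hP.isCompact_Q.bddAbove_image hcont
  exact ⟨C, fun β hβ => (hP.φ_le hβ hu).trans (hC (mem_image_of_mem _ hβ))⟩

/-- The reduced lower-level objective is coercive in the control, uniformly in `β`. -/
theorem exists_norm_le (hP : P.StandingAssumptions) (C : ℝ) : ∃ M, 0 ≤ M ∧ ∀ β ∈ P.Q,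
    ∀ u ∈ P.Uad, P.f (P.lift (β, u)) ≤ C → ‖u‖ ≤ M := by
  obtain ⟨v, hv⟩ := hP.Uad_nonempty
  obtain ⟨c, hc, hmid⟩ := hP.midpoint_lower
  obtain ⟨m, hm⟩ := hP.f_bddBelow
  have hcont : ContinuousOn (fun β => P.f (P.lift (β, v))) P.Q :=
    (continuousOn_comp_lift hP.f_contDiff).comp (by fun_prop) fun β hβ => ⟨hβ, mem_univ _⟩
  obtain ⟨D, hD⟩ := hP.isCompact_Q.bddAbove_image hcont
  -- The control u is compared with the fixed v: D bounds f at v over Q, and m bounds f at the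
  -- midpoint from below.
  refine ⟨Real.sqrt (((C + D) / 2 - m) / c) + ‖v‖, by positivity, fun β hβ u hu hC => ?_⟩
  have h1 := hmid β hβ u hu v hv
  have h2 : m ≤ P.f (P.lift (β, midpoint ℝ u v)) := hm (mem_image_of_mem _ (lift_mem_dom hβ _))
  have h3 : P.f (P.lift (β, v)) ≤ D := hD (mem_image_of_mem _ hβ)
  have h4 : ‖u - v‖ ≤ Real.sqrt (((C + D) / 2 - m) / c) := by
    refine Real.le_sqrt_of_sq_le ?_
    rw [le_div_iff₀ hc]
    linarith
  have h5 : ‖u‖ ≤ ‖u - v‖ + ‖v‖ := by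
    simpa using norm_add_le (u - v) v
  linarith

/-- The reduced lower-level objective is Lipschitz in `β`, uniformly on bounded sublevel sets. -/
theorem exists_lipschitz (hP : P.StandingAssumptions) (C : ℝ) : ∃ L, 0 ≤ L ∧
    ∀ β ∈ P.Q, ∀ u ∈ P.Uad, P.f (P.lift (β, u)) ≤ C → ∀ β₁ ∈ P.Q, ∀ β₂ ∈ P.Q,
      P.f (P.lift (β₁, u)) ≤ P.f (P.lift (β₂, u)) + L * ‖β₁ - β₂‖ := by
  obtain ⟨M, hM, hbd⟩ := hP.exists_norm_le C
  obtain ⟨v, hv⟩ := hP.Uad_nonempty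
  obtain ⟨β₀, hβ₀⟩ := hP.Q_nonempty
  obtain ⟨r, hr⟩ := hP.Q_bounded.exists_norm_le
  set N := max (max M ‖v‖) (‖P.S‖ * max M ‖v‖) with hN
  have hN0 : 0 ≤ N := hM.trans ((le_max_left _ _).trans (le_max_left _ _))
  obtain ⟨L, hL, hlip⟩ := hP.lipschitz N hN0
  have hu_mem : ∀ w : U, ‖w‖ ≤ max M ‖v‖ → ‖w‖ ≤ N ∧ ‖P.S w‖ ≤ N := fun w hw =>
    ⟨hw.trans (le_max_left _ _), (P.S.le_opNorm w).trans ((mul_le_mul_of_nonneg_left hw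
      (norm_nonneg _)).trans (le_max_right _ _))⟩
  obtain ⟨hv1, hv2⟩ := hu_mem v (le_max_right _ _)
  have hr0 : 0 ≤ r := (norm_nonneg _).trans (hr β₀ hβ₀)
  -- The β-derivative is Lipschitz on bounded sets, hence bounded there by its norm at the reference
  -- point (β₀, S v, v) plus L times the largest possible distance.
  set K := ‖P.fβ β₀ (P.S v) v‖ + L * (2 * r + 2 * N + 2 * N) with hK
  have hK0 : 0 ≤ K := by positivity
  refine ⟨K, hK0, fun β hβ u hu hfu β₁ hβ₁ β₂ hβ₂ => ?_⟩
  obtain ⟨hu1, hu2⟩ := hu_mem u ((hbd β hβ u hu hfu).trans (le_max_left _ _))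
  have hdiff : DifferentiableOn ℝ (fun b => P.f (b, P.S u, u)) P.Q :=
    (hP.f_contDiff.differentiableOn one_ne_zero).comp (by fun_prop) fun b hb => ⟨hb, mem_univ _⟩
  have hbound : ∀ b ∈ P.Q, ‖fderivWithin ℝ (fun b => P.f (b, P.S u, u)) P.Q b‖ ≤ K := by
    intro b hb
    have h1 := (hlip b hb b hb β₀ hβ₀ (P.S u) (by simpa using hu2) (P.S v) (by simpa using hv2)
      u ⟨hu, by simpa using hu1⟩ u ⟨hu, by simpa using hu1⟩ v ⟨hv, by simpa using hv1⟩).1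
    have h2 : ‖b - β₀‖ + ‖P.S u - P.S v‖ + ‖u - v‖ ≤ 2 * r + 2 * N + 2 * N := by
      have := norm_sub_le b β₀
      have := norm_sub_le (P.S u) (P.S v)
      have := norm_sub_le u v
      have := hr b hb
      have := hr β₀ hβ₀
      linarith
    have h3 := mul_le_mul_of_nonneg_left h2 hL
    have h4 : ‖P.fβ b (P.S u) u‖ ≤ ‖P.fβ b (P.S u) u - P.fβ β₀ (P.S v) v‖
        + ‖P.fβ β₀ (P.S v) v‖ := by
      simpa using norm_add_le (P.fβ b (P.S u) u - P.fβ β₀ (P.S v) v) (P.fβ β₀ (P.S v) v)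
    change ‖P.fβ b (P.S u) u‖ ≤ K
    linarith
  have h := hP.convex_Q.norm_image_sub_le_of_norm_fderivWithin_le hdiff hbound hβ₂ hβ₁
  have h' := (le_abs_self _).trans h
  simp only [lift_apply]
  linarith

/-- The optimal-value function is Lipschitz on `Q`. -/
theorem exists_φ_lipschitz [CompleteSpace U] (hP : P.StandingAssumptions) : ∃ L, 0 ≤ L ∧
    ∀ β₁ ∈ P.Q, ∀ β₂ ∈ P.Q, P.φ β₁ ≤ P.φ β₂ + L * ‖β₁ - β₂‖ := by
  obtain ⟨C, hC⟩ := hP.φ_bddAbove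
  obtain ⟨L, hL, hlip⟩ := hP.exists_lipschitz C
  refine ⟨L, hL, fun β₁ h₁ β₂ h₂ => ?_⟩
  -- The minimizer at β₂ is a competitor at β₁.
  obtain ⟨u, hu, hφ⟩ := hP.exists_lower_solution h₂
  have h := hlip β₂ h₂ u hu (hφ.le.trans (hC _ h₂)) β₁ h₁ β₂ h₂
  rw [hφ] at h
  exact (hP.φ_le h₁ hu).trans h

/-- Lower-level minimizers at the vertices, combined with the barycentric coordinates of β, form an
admissible control at β; Jensen's inequality for the jointly convex reduced objective bounds its
value by the interpolant. -/
theorem φ_le_interp [CompleteSpace U] (hP : P.StandingAssumptions) {T : Simplex n}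
    (hT : T.carrier ⊆ P.Q) {β : Euc n} (hβ : β ∈ T.carrier) : P.φ β ≤ T.interp P.φ β := by
  have hv : ∀ i, T i ∈ P.Q := fun i => hT (T.vertex_mem_carrier i)
  choose u hu hφ using fun i => hP.exists_lower_solution (hv i)
  have h := (convexOn_comp_lift hP.f_convex).map_sum_le (t := Finset.univ)
    (w := fun i => T.coord i β) (p := fun i => (T i, u i))
    (fun i _ => Simplex.coord_nonneg hβ i) (T.sum_coord_apply_eq_one β)
    (fun i _ => ⟨hv i, mem_univ _⟩)
  have e : ∑ i, T.coord i β • ((T i, u i) : Euc n × U) = (β, ∑ i, T.coord i β • u i) := by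
    refine Prod.ext ?_ ?_
    · rw [Prod.fst_sum]
      exact T.linear_combination_coord_eq_self β
    · rw [Prod.snd_sum]
      rfl
  rw [e] at h
  have hw : ∑ i, T.coord i β • u i ∈ P.Uad := hP.Uad_convex.sum_mem
    (fun i _ => Simplex.coord_nonneg hβ i) (T.sum_coord_apply_eq_one β) (fun i _ => hu i)
  refine (hP.φ_le (hT hβ) hw).trans (h.trans_eq ?_)
  unfold Simplex.interp
  simp only [hφ, smul_eq_mul]

/-- The relaxation error: every vertex is within the diameter of β, and the interpolant is a convex
combination of vertex values. -/
theorem interp_le_φ_add {L : ℝ} (hL : 0 ≤ L)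
    (hlip : ∀ β₁ ∈ P.Q, ∀ β₂ ∈ P.Q, P.φ β₁ ≤ P.φ β₂ + L * ‖β₁ - β₂‖) {T : Simplex n}
    (hT : T.carrier ⊆ P.Q) {β : Euc n} (hβ : β ∈ T.carrier) :
    T.interp P.φ β ≤ P.φ β + L * Metric.diam T.carrier := by
  refine Simplex.interp_le hβ fun i => ?_
  have hi := T.vertex_mem_carrier i
  refine (hlip _ (hT hi) β (hT hβ)).trans ?_
  rw [← dist_eq_norm]
  have := Metric.dist_le_diam_of_mem T.isCompact_carrier.isBounded hi hβ
  gcongr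

/-- The subproblems are solvable. -/
theorem exists_solvesOn [CompleteSpace U] (hP : P.StandingAssumptions) (T : Simplex n)
    (hT : T.carrier ⊆ P.Q) : ∃ x, P.SolvesOn T x := by
  set D : Set (Euc n × U) := T.carrier ×ˢ P.Uad with hD
  have hDQ : D ⊆ P.Q ×ˢ univ := fun x hx => ⟨hT hx.1, mem_univ _⟩
  have hDcl : IsClosed D := T.isCompact_carrier.isClosed.prod hP.Uad_closed
  -- Since the interpolant is affine, this constraint is convex, whereas f - φ need not be. At a
  -- vertex it is met by the lower-level minimizer.
  set K : Set (Euc n × U) := {x ∈ D | P.f (P.lift x) - T.interp P.φ x.1 ≤ 0} with hK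
  have hKD : K ⊆ D := fun x hx => hx.1
  have hDcv : Convex ℝ D := T.convex_carrier.prod hP.Uad_convex
  have hKcl : IsClosed K := by
    refine ContinuousOn.preimage_isClosed_of_isClosed
      (f := fun x : Euc n × U => P.f (P.lift x) - T.interp P.φ x.1) ?_ hDcl isClosed_Iic
    exact ((continuousOn_comp_lift hP.f_contDiff).mono hDQ).sub
      ((T.continuous_interp P.φ).comp continuous_fst).continuousOn
  have hKcv : Convex ℝ K := by
    intro x hx y hy a b ha hb hab
    refine ⟨hDcv hx.1 hy.1 ha hb hab, ?_⟩
    have h1 := (convexOn_comp_lift hP.f_convex).2 (hDQ hx.1) (hDQ hy.1) ha hb hab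
    have h2 := T.interp_combo P.φ x.1 y.1 hab
    have h3 := mul_le_mul_of_nonneg_left hx.2 ha
    have h4 := mul_le_mul_of_nonneg_left hy.2 hb
    simp only [smul_eq_mul] at h1
    rw [Prod.fst_add, Prod.smul_fst, Prod.smul_fst, h2]
    linarith
  have hKne : K.Nonempty := by
    obtain ⟨u, hu, hφ⟩ := hP.exists_lower_solution (hT (T.vertex_mem_carrier 0))
    refine ⟨(T 0, u), ⟨T.vertex_mem_carrier 0, hu⟩, ?_⟩
    change P.f (P.lift (T 0, u)) - T.interp P.φ (T 0) ≤ 0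
    rw [T.interp_vertex, hφ, sub_self]
  obtain ⟨C, hC⟩ := hP.φ_bddAbove
  obtain ⟨M, -, hM⟩ := hP.exists_norm_le C
  have hKbd : Bornology.IsBounded K := by
    refine (hP.Q_bounded.prod (Metric.isBounded_closedBall (x := (0 : U)) (r := M))).subset ?_
    rintro ⟨β, u⟩ ⟨⟨hβ, hu⟩, hf⟩
    refine ⟨hT hβ, mem_closedBall_zero_iff.2 (hM β (hT hβ) u hu ?_)⟩
    exact (sub_nonpos.1 hf).trans
      (Simplex.interp_le hβ fun i => hC _ (hT (T.vertex_mem_carrier i)))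
  obtain ⟨x, hx, hmin⟩ := exists_isMinOn_prod hKcl hKne hKbd
    ((convexOn_comp_lift hP.F_convex).subset (hKD.trans hDQ) hKcv)
    ((continuousOn_comp_lift hP.F_contDiff).mono (hKD.trans hDQ))
    (hP.F_bddBelow.mono <| by
      rintro _ ⟨x, hx, rfl⟩
      exact mem_image_of_mem _ (lift_mem_dom (hDQ (hKD hx)).1 x.2))
  refine ⟨P.lift x, mem_feasible_iff.2 ⟨x.1, hx.1.1, x.2, hx.1.2, sub_nonpos.1 hx.2, rfl⟩,
    fun z hz => ?_⟩
  obtain ⟨β, hβ, u, hu, hf, rfl⟩ := mem_feasible_iff.1 hz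
  exact hmin (β, u) ⟨⟨hβ, hu⟩, sub_nonpos.2 hf⟩

end StandingAssumptions

end Problem

end BilevelOC

/-! ### Runs of the algorithm: lower bounds, shrinking simplices, convergence -/

namespace BilevelOC

namespace Problem

variable {n : ℕ} {Y U : Type*}
  [NormedAddCommGroup Y] [InnerProductSpace ℝ Y]
  [NormedAddCommGroup U] [InnerProductSpace ℝ U]
  {P : Problem n Y U} {q ρ : ℝ} {N : ℕ∞} {s : ℕ → AlgState n Y U}

namespace IsInitial

/-- The properties of an initial state are preserved by each step. -/
theorem of_isStep {t t' : AlgState n Y U} (h : P.IsInitial ρ t) (hs : P.IsStep q ρ t t') :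
    P.IsInitial ρ t' := by
  obtain ⟨hnot, R, hR, hcov, hmesh⟩ := hs.refines
  refine ⟨?_, ?_, ?_, ?_, hs.selects⟩
  · rw [hmesh]
    exact (h.finite.subset sdiff_subset).union hR
  · rw [hmesh, biUnion_union, hcov, ← h.covers]
    apply Subset.antisymm
    · refine union_subset (biUnion_subset_biUnion_left sdiff_subset) ?_
      exact subset_biUnion_of_mem (u := fun T : Simplex n => T.carrier) h.selects.1
    · refine iUnion₂_subset fun T hT => ?_
      by_cases hc : T = t.cell
      · rw [hc]
        exact subset_union_right
      · exact Subset.trans (subset_biUnion_of_mem (u := fun T : Simplex n => T.carrier)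
          (show T ∈ t.mesh \ {t.cell} from ⟨hT, hc⟩)) subset_union_left
  · intro T hT
    by_cases hc : T ∈ t.mesh
    · exact h.aspect T hc
    · exact hs.aspect T ⟨hT, hc⟩
  · intro T hT
    by_cases hc : T ∈ t.mesh
    · rw [hs.keeps T ⟨hT, hc⟩]
      exact h.solves T hc
    · exact hs.solves T ⟨hT, hc⟩

theorem carrier_subset {t : AlgState n Y U} (h : P.IsInitial ρ t) {T : Simplex n}
    (hT : T ∈ t.mesh) : T.carrier ⊆ P.Q := by
  rw [← h.covers]
  exact subset_biUnion_of_mem (u := fun T : Simplex n => T.carrier) hT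

/-- The iterate is feasible for the subproblem on the selected simplex. -/
theorem iterate_mem {t : AlgState n Y U} (h : P.IsInitial ρ t) :
    t.iterate ∈ P.feasible t.cell.carrier (t.cell.interp P.φ) :=
  (h.solves _ h.selects.1).1

/-- The value of the iterate is a lower bound for the optimal-value reformulation. -/
theorem le_of_mem_feasible [CompleteSpace U] (hP : P.StandingAssumptions) {t : AlgState n Y U}
    (h : P.IsInitial ρ t) {z : Euc n × Y × U} (hz : z ∈ P.feasible P.Q P.φ) :
    P.F t.iterate ≤ P.F z := by
  obtain ⟨h1, h2, h3⟩ := hz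
  rw [← h.covers, mem_iUnion₂] at h1
  obtain ⟨T, hT, hzT⟩ := h1
  exact (h.selects.2 T hT).trans ((h.solves T hT).2 z
    ⟨hzT, h2.trans (hP.φ_le_interp (h.carrier_subset hT) hzT), h3⟩)

theorem solvesOVR_of_stops [CompleteSpace U] (hP : P.StandingAssumptions) {t : AlgState n Y U}
    (h : P.IsInitial ρ t) (hterm : P.Stops t) : P.SolvesOVR t.iterate := by
  obtain ⟨h1, -, h3⟩ := h.iterate_mem
  exact ⟨⟨h.carrier_subset h.selects.1 h1, le_of_eq hterm, h3⟩,
    fun z hz => h.le_of_mem_feasible hP hz⟩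

end IsInitial

namespace IsRun

theorem isInitial (h : P.IsRun q ρ N s) (k : ℕ) (hk : (k : ℕ∞) ≤ N) : P.IsInitial ρ (s k) := by
  induction k with
  | zero => exact h.init
  | succ k ih =>
    have hlt : (k : ℕ∞) < N := lt_of_lt_of_le (by exact_mod_cast k.lt_succ_self) hk
    exact (ih hlt.le).of_isStep (h.step k hlt).2

/-- If the volumes of the selected simplices are eventually at most `v`, then they are
eventually at most `q v`: each later selection of a larger simplex would diminish the finite
number of these. -/
theorem eventually_vol_le_mul (h : P.IsRun q ρ ⊤ s) {v : ℝ}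
    (hv : ∀ᶠ k in atTop, (s k).cell.vol ≤ v) : ∀ᶠ k in atTop, (s k).cell.vol ≤ q * v := by
  obtain ⟨K, hK⟩ := eventually_atTop.1 hv
  set H : ℕ → Set (Simplex n) := fun k => {T ∈ (s (K + k)).mesh | q * v < T.vol} with hH
  have hfin : ∀ k, (H k).Finite := fun k => (h.isInitial _ le_top).finite.subset fun T hT => hT.1
  have hsub : ∀ k, H (k + 1) ⊆ H k := by
    rintro k T ⟨hT, hvT⟩
    refine ⟨?_, hvT⟩
    by_contra hc
    -- A new simplex has volume at most q times that of the selected one, hence at most q v, so none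
    -- enters `H`.
    have h1 := (h.step (K + k) (ENat.natCast_lt_top _)).2.volume_le T ⟨hT, hc⟩
    have h2 := mul_le_mul_of_nonneg_left (hK (K + k) (Nat.le_add_right _ _)) h.q_mem.1.le
    linarith
  have hcard : Antitone fun k => (H k).ncard :=
    antitone_nat_of_succ_le fun k => ncard_le_ncard (hsub k) (hfin k)
  -- From an index k₀ of minimal cardinality on, the count cannot drop; selecting a member of `H`
  -- would remove it for good.
  obtain ⟨m, hm⟩ := WellFounded.has_min (wellFounded_lt (α := ℕ))
    (range fun k => (H k).ncard) (range_nonempty _)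
  obtain ⟨⟨k₀, rfl⟩, hmin⟩ := hm
  refine eventually_atTop.2 ⟨K + k₀, fun j hj => ?_⟩
  obtain ⟨i, rfl⟩ := Nat.exists_eq_add_of_le hj
  by_contra hc
  rw [not_le, add_assoc] at hc
  have hmem : (s (K + (k₀ + i))).cell ∈ H (k₀ + i) :=
    ⟨(h.isInitial _ le_top).selects.1, hc⟩
  have hnot : (s (K + (k₀ + i))).cell ∉ H (k₀ + i + 1) := fun hT =>
    (h.step (K + (k₀ + i)) (ENat.natCast_lt_top _)).2.refines.1 hT.1
  have hlt : (H (k₀ + i + 1)).ncard < (H (k₀ + i)).ncard :=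
    ncard_lt_ncard ⟨hsub _, fun hs => hnot (hs hmem)⟩ (hfin _)
  exact hmin _ (mem_range_self (k₀ + i + 1))
    (hlt.trans_le (hcard (Nat.le_add_right k₀ i)))

/-- Iterating the previous bound from the volume of Q gives q ^ m times that volume. Only selected
simplices need shrink, not the whole mesh. -/
theorem tendsto_vol (hP : P.StandingAssumptions) (h : P.IsRun q ρ ⊤ s) :
    Tendsto (fun k => (s k).cell.vol) atTop (𝓝 0) := by
  set V := (volume : Measure (Euc n)).real P.Q with hV
  have h0 : ∀ k, (s k).cell.vol ≤ V := fun k =>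
    measureReal_mono ((h.isInitial k le_top).carrier_subset (h.isInitial k le_top).selects.1)
      hP.isCompact_Q.measure_lt_top.ne
  have hm : ∀ m : ℕ, ∀ᶠ k in atTop, (s k).cell.vol ≤ q ^ m * V := by
    intro m
    induction m with
    | zero => exact Eventually.of_forall fun k => by simpa using h0 k
    | succ m ih =>
      have := h.eventually_vol_le_mul ih
      rwa [← mul_assoc, ← pow_succ'] at this
  have hlim : Tendsto (fun m : ℕ => q ^ m * V) atTop (𝓝 0) := by
    simpa using (tendsto_pow_atTop_nhds_zero_of_lt_one h.q_mem.1.le h.q_mem.2).mul_const V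
  refine tendsto_order.2 ⟨fun a ha => Eventually.of_forall fun k =>
    ha.trans_le measureReal_nonneg, fun a ha => ?_⟩
  obtain ⟨m, hma⟩ := (hlim.eventually (gt_mem_nhds ha)).exists
  exact (hm m).mono fun k hk => hk.trans_lt hma

theorem tendsto_diam (hP : P.StandingAssumptions) (h : P.IsRun q ρ ⊤ s) :
    Tendsto (fun k => Metric.diam (s k).cell.carrier) atTop (𝓝 0) := by
  have hρ := h.ρ_mem.1
  have hge := fun k => Simplex.volume_ge hρ
    ((h.isInitial k le_top).aspect _ (h.isInitial k le_top).selects.1)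
  have hn : 0 < n := (hge 0).1
  set ω := (volume : Measure (Euc n)).real (Metric.ball 0 1) with hω
  have hω0 : 0 < ω := ENNReal.toReal_pos (Metric.measure_ball_pos _ _ one_pos).ne'
    measure_ball_lt_top.ne
  refine tendsto_order.2 ⟨fun a ha => Eventually.of_forall fun k =>
    ha.trans_le Metric.diam_nonneg, fun a ha => ?_⟩
  have hpos : 0 < (ρ * a / 4) ^ n * ω := by positivity
  refine ((h.tendsto_vol hP).eventually (gt_mem_nhds hpos)).mono fun k hk => ?_
  have h1 := lt_of_mul_lt_mul_right ((hge k).2.trans_lt hk) hω0.le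
  have h2 := lt_of_pow_lt_pow_left₀ n (by positivity) h1
  have h3 : ρ * Metric.diam (s k).cell.carrier < ρ * a := by linarith
  exact lt_of_mul_lt_mul_left h3 hρ.le

/-- Every subsequence of the iterates has a further subsequence that converges strongly to a
global solution. -/
theorem exists_subseq_tendsto [CompleteSpace U] (hP : P.StandingAssumptions)
    (h : P.IsRun q ρ ⊤ s) {i : ℕ → ℕ} (hi : Tendsto i atTop atTop) :
    ∃ (j : ℕ → ℕ) (x : Euc n × Y × U), StrictMono j ∧ P.SolvesOVR x ∧
      Tendsto (fun k => (s (i (j k))).iterate) atTop (𝓝 x) := by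
  have hI := fun k => h.isInitial k le_top
  have hcell := fun k => (hI k).carrier_subset (hI k).selects.1
  choose β hβ u hu hf hx using fun k => mem_feasible_iff.1 (hI k).iterate_mem
  have hβQ := fun k => hcell k (hβ k)
  -- Compactness is used only in the finite-dimensional variable.
  obtain ⟨b, hb, j, hj, hjb⟩ := hP.isCompact_Q.tendsto_subseq (fun k => hβQ (i k))
  obtain ⟨v, hv, hvφ⟩ := hP.exists_lower_solution hb
  obtain ⟨C, hC⟩ := hP.φ_bddAbove
  obtain ⟨L, hL, hlip⟩ := hP.exists_φ_lipschitz
  obtain ⟨L', hL', hlip'⟩ := hP.exists_lipschitz C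
  obtain ⟨c, hc, hgrow⟩ := hP.norm_sub_sq_le
  have hij : Tendsto (fun k => i (j k)) atTop atTop := hi.comp hj.tendsto_atTop
  -- The gap f(b, S u_k, u_k) - φ(b) splits into the change of f from β_k to b (L'), the relaxation
  -- error at β_k (L times the diameter), and the change of φ from β_k to b (L). Quadratic growth at
  -- b converts the gap into a distance.
  have hest : ∀ k, ‖u k - v‖ ≤ Real.sqrt ((L * Metric.diam (s k).cell.carrier
      + (L + L') * ‖β k - b‖) / c) := by
    intro k
    have h1 := hgrow b hb (u k) (hu k) v hv hvφ
    have h2 := hlip' (β k) (hβQ k) (u k) (hu k) ((hf k).trans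
      (Simplex.interp_le (hβ k) fun l => hC _ (hcell k (Simplex.vertex_mem_carrier _ l))))
      b hb (β k) (hβQ k)
    have h3 := StandingAssumptions.interp_le_φ_add hL hlip (hcell k) (hβ k)
    have h4 := hlip (β k) (hβQ k) b hb
    have h5 := hf k
    rw [norm_sub_rev b (β k)] at h2
    refine Real.le_sqrt_of_sq_le ?_
    rw [le_div_iff₀ hc]
    linarith
  have hβlim : Tendsto (fun k => β (i (j k))) atTop (𝓝 b) := hjb
  have hbound : Tendsto (fun k => Real.sqrt ((L * Metric.diam (s (i (j k))).cell.carrier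
      + (L + L') * ‖β (i (j k)) - b‖) / c)) atTop (𝓝 0) := by
    have h1 := (((h.tendsto_diam hP).comp hij).const_mul L).add
      ((tendsto_iff_norm_sub_tendsto_zero.1 hβlim).const_mul (L + L'))
    have h2 := (Real.continuous_sqrt.tendsto _).comp (h1.div_const c)
    simpa [Function.comp_def] using h2
  have hulim : Tendsto (fun k => u (i (j k))) atTop (𝓝 v) :=
    tendsto_iff_norm_sub_tendsto_zero.2
      (squeeze_zero (fun _ => norm_nonneg _) (fun k => hest (i (j k))) hbound)
  have hxlim : Tendsto (fun k => (s (i (j k))).iterate) atTop (𝓝 (P.lift (b, v))) := by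
    have := (P.lift.continuous.tendsto (b, v)).comp (hβlim.prodMk_nhds hulim)
    refine this.congr fun k => ?_
    exact hx (i (j k))
  have hdom : ∀ k, (s k).iterate ∈ P.dom := fun k => by
    rw [← hx k]
    exact StandingAssumptions.lift_mem_dom (hβQ k) _
  have hbdom : P.lift (b, v) ∈ P.dom := StandingAssumptions.lift_mem_dom hb v
  have hFlim : Tendsto (fun k => P.F (s (i (j k))).iterate) atTop (𝓝 (P.F (P.lift (b, v)))) :=
    (hP.F_contDiff.continuousOn _ hbdom).tendsto.comp
      (tendsto_nhdsWithin_iff.2 ⟨hxlim, Eventually.of_forall fun k => hdom _⟩)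
  exact ⟨j, P.lift (b, v), hj, ⟨mem_feasible_iff.2 ⟨b, hb, v, hv, hvφ.le, rfl⟩,
    fun z hz => le_of_tendsto' hFlim fun k => (hI _).le_of_mem_feasible hP hz⟩, hxlim⟩

end IsRun

end Problem

end BilevelOC

theorem mainTheorem1 {n : ℕ} {Y U : Type*}
    [NormedAddCommGroup Y] [InnerProductSpace ℝ Y] [CompleteSpace Y]
    [NormedAddCommGroup U] [InnerProductSpace ℝ U] [CompleteSpace U]
    (P : BilevelOC.Problem n Y U) (hP : P.StandingAssumptions) :
    -- the subproblems of the algorithm are solvable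
    (∀ T : BilevelOC.Simplex n, T.carrier ⊆ P.Q → ∃ x, P.SolvesOn T x) ∧
    ∀ (q ρ : ℝ) (N : ℕ∞) (s : ℕ → BilevelOC.AlgState n Y U), P.IsRun q ρ N s →
      -- the algorithm stops at a global solution, or a subsequence converges to one
      ((∃ k : ℕ, N = (k : ℕ∞) ∧ P.SolvesOVR (s k).iterate) ∨
        (N = ⊤ ∧ ∃ (j : ℕ → ℕ) (xhat : BilevelOC.Euc n × Y × U), StrictMono j ∧
          P.SolvesOVR xhat ∧ Tendsto (fun k => (s (j k)).iterate) atTop (𝓝 xhat))) ∧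
      -- if the global solution is unique, the whole sequence converges to it
      (N = ⊤ → ∀ xbar : BilevelOC.Euc n × Y × U,
        (P.SolvesOVR xbar ∧ ∀ z, P.SolvesOVR z → z = xbar) →
          Tendsto (fun k => (s k).iterate) atTop (𝓝 xbar)) := by
  refine ⟨fun T hT => hP.exists_solvesOn T hT, fun q ρ N s h => ⟨?_, ?_⟩⟩
  · induction N using ENat.recTopCoe with
    | top =>
      obtain ⟨j, x, hj, hx, hlim⟩ := h.exists_subseq_tendsto hP tendsto_id
      exact Or.inr ⟨rfl, j, x, hj, hx, hlim⟩
    | coe k =>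
      exact Or.inl ⟨k, rfl, (h.isInitial k le_rfl).solvesOVR_of_stops hP (h.terminates k rfl)⟩
  · rintro rfl xbar ⟨-, huniq⟩
    -- Every subsequence has a further one converging to some global solution, which uniqueness
    -- identifies as `xbar`.
    refine tendsto_of_subseq_tendsto fun i hi => ?_
    obtain ⟨j, x, -, hx, hlim⟩ := h.exists_subseq_tendsto hP hi
    rw [huniq x hx] at hlim
    exact ⟨j, hlim⟩
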